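/- **Setting.** C*-algebras are complex and unital (the zero algebra is allowed). An element $x$ of a C*-algebra is *positive* if $x=y^*y$ for some $y$. A *positive unital map* $f\colon\mathcal A\to\mathcal B$ is a $\mathbb C$-linear map with $f(1)=1$ and $f(x^*x)$ positive for all $x\in\mathcal A$. Let $\mathbf{CstPU}$ be the category of C*-algebras and positive unital maps. Let $\mathbf{ConCom}$ be the category whose objects are pairs $(V,X)$ with $V$ a (possibly empty) compact convex subset of a locally convex Hausdorff real topological vector space $X$, and whose morphisms $(V,X)\to(W,Y)$ are the continuous affine maps $V\to W$. The *state space* $S(\mathcal A)$ is the set of positive unital maps $\mathcal A\to\mathbb C$ with pointwise convex combinations and the coarsest topology making every evaluation $\rho\mapsto\rho(a)$, $a\in\mathcal A$, continuous. It is a compact convex space, and $S(f)=(-)\circ f$ defines a functor $S\colon\mathbf{CstPU}^{\mathrm{op}}\to\mathbf{ConCom}$. **Lemma 3.1** (State space functor preserves and reflects limits). The functor $S\colon\mathbf{CstPU}^{\mathrm{op}}\to\mathbf{ConCom}$ preserves and reflects limits (over index categories of any size). That is, for every category $\mathcal J$, every diagram $\mathcal A_{-}\colon\mathcal J\to\mathbf{CstPU}$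 and every cocone $(\mathcal A_j\to\mathcal B)_{j\in\mathcal J}$ over it, the cocone is a colimit in $\mathbf{CstPU}$ if and only if the induced cone $(S(\mathcal B)\to S(\mathcal A_j))_{j\in\mathcal J}$ is a limit in $\mathbf{ConCom}$ of the induced diagram $\mathcal J^{\mathrm{op}}\to\mathbf{ConCom}$. -/

import Mathlib

open CategoryTheory

universe u w w'

/-! ## C*-algebras with positive unital maps -/

/-- An element `x` of a C*-algebra is positive if `x = y* y` for some `y`. -/
def IsPosElt {A : Type*} [CStarAlgebra A] (x : A) : Prop :=
  ∃ y : A, x = star y * y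

/-- Positive unital maps between (unital) C*-algebras: complex-linear maps that send every
`x* x` to a positive element and the unit to the unit. -/
structure PUMap (A : Type*) (B : Type*) [CStarAlgebra A] [CStarAlgebra B]
    extends A →ₗ[ℂ] B where
  map_one' : toFun 1 = 1
  map_pos' : ∀ x : A, IsPosElt (toFun (star x * x))

namespace PUMap

variable {A B C : Type*} [CStarAlgebra A] [CStarAlgebra B] [CStarAlgebra C]

instance : FunLike (PUMap A B) A B where
  coe f := f.toFun
  coe_injective f g h := by
    cases f; cases g
    congr
    exact DFunLike.coe_injective h

@[ext] theorem ext {f g : PUMap A B} (h : ∀ x, f x = g x) : f = g := DFunLike.ext _ _ h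

theorem map_one (f : PUMap A B) : f 1 = 1 := f.map_one'

theorem map_pos (f : PUMap A B) (x : A) : IsPosElt (f (star x * x)) := f.map_pos' x

theorem map_add (f : PUMap A B) (x y : A) : f (x + y) = f x + f y := f.toLinearMap.map_add x y

theorem map_smul (f : PUMap A B) (c : ℂ) (x : A) : f (c • x) = c • f x :=
  f.toLinearMap.map_smul c x

/-- The identity map. -/
noncomputable def id (A : Type*) [CStarAlgebra A] : PUMap A A where
  toLinearMap := LinearMap.id
  map_one' := rfl
  map_pos' x := ⟨x, rfl⟩

/-- Composition of positive unital maps. -/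
noncomputable def comp (g : PUMap B C) (f : PUMap A B) : PUMap A C where
  toLinearMap := g.toLinearMap.comp f.toLinearMap
  map_one' := by
    change g (f 1) = 1
    rw [f.map_one, g.map_one]
  map_pos' x := by
    obtain ⟨y, hy⟩ := f.map_pos x
    change IsPosElt (g (f (star x * x)))
    rw [hy]
    exact g.map_pos y

end PUMap

/-- The objects of the category of (unital) C*-algebras and positive unital maps. -/
structure CstPU : Type (u + 1) where
  carrier : Type u
  [cstar : CStarAlgebra carrier]

attribute [instance] CstPU.cstar

/-- The category of C*-algebras and positive unital maps. -/
noncomputable instance : Category CstPU.{u} where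
  Hom A B := PUMap A.carrier B.carrier
  id A := PUMap.id A.carrier
  comp f g := PUMap.comp g f

/-! ## Compact convex spaces -/

/-- A compact convex space: a compact convex subset `carrier` of a locally convex Hausdorff
(real) topological vector space `space`. -/
structure ConCom : Type (u + 1) where
  space : Type u
  [addCommGroup : AddCommGroup space]
  [module : Module ℝ space]
  [topologicalSpace : TopologicalSpace space]
  [isTopologicalAddGroup : IsTopologicalAddGroup space]
  [continuousSMul : ContinuousSMul ℝ space]
  [locallyConvexSpace : LocallyConvexSpace ℝ space]
  [t2Space : T2Space space]
  carrier : Set space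
  convex : Convex ℝ carrier
  isCompact : IsCompact carrier

attribute [instance] ConCom.addCommGroup ConCom.module ConCom.topologicalSpace
  ConCom.isTopologicalAddGroup ConCom.continuousSMul ConCom.locallyConvexSpace ConCom.t2Space

namespace ConCom

/-- The convex combination `a x + b y` in a compact convex space. -/
def combo (V : ConCom.{u}) (a b : ℝ) (ha : 0 ≤ a) (hb : 0 ≤ b) (hab : a + b = 1)
    (x y : V.carrier) : V.carrier :=
  ⟨a • (x : V.space) + b • (y : V.space), V.convex x.2 y.2 ha hb hab⟩

/-- Morphisms of compact convex spaces: continuous affine maps between the convex sets only. -/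
@[ext]
structure Hom (V W : ConCom.{u}) where
  toFun : V.carrier → W.carrier
  continuous_toFun : Continuous toFun
  map_combo : ∀ (a b : ℝ) (ha : 0 ≤ a) (hb : 0 ≤ b) (hab : a + b = 1) (x y : V.carrier),
    toFun (V.combo a b ha hb hab x y) = W.combo a b ha hb hab (toFun x) (toFun y)

/-- The category of compact convex spaces and continuous affine maps. -/
instance : Category ConCom.{u} where
  Hom V W := Hom V W
  id V := ⟨fun x => x, continuous_id, fun _ _ _ _ _ _ _ => rfl⟩
  comp f g := ⟨fun x => g.toFun (f.toFun x), g.continuous_toFun.comp f.continuous_toFun,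
    fun a b ha hb hab x y => by rw [f.map_combo, g.map_combo]⟩

end ConCom

/-! ## The state space -/

section StateSpace

variable (A : Type u) [CStarAlgebra A]

/-- The states of `A`, i.e. the positive unital maps `A → ℂ`, as a subset of the space `A → ℂ` of
all functions with the topology of pointwise convergence.  The subspace topology is thus the
coarsest one for which all evaluations are continuous, and convex combinations are pointwise. -/
def stateSet : Set (A → ℂ) :=
  Set.range (fun ρ : PUMap A ℂ => (ρ : A → ℂ))

variable {A}

theorem isPosElt_complex_iff (z : ℂ) : IsPosElt z ↔ 0 ≤ z.re ∧ z.im = 0 := by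
  constructor
  · rintro ⟨y, rfl⟩
    simp only [Complex.star_def, Complex.mul_re, Complex.mul_im, Complex.conj_re, Complex.conj_im]
    exact ⟨by nlinarith [sq_nonneg y.re, sq_nonneg y.im], by ring⟩
  · rintro ⟨h1, h2⟩
    refine ⟨(Real.sqrt z.re : ℂ), ?_⟩
    rw [Complex.star_def, Complex.conj_ofReal, ← Complex.ofReal_mul, Real.mul_self_sqrt h1]
    exact Complex.ext (by simp) (by simp [h2])

theorem mem_stateSet_iff (f : A → ℂ) :
    f ∈ stateSet A ↔ (∀ x y, f (x + y) = f x + f y) ∧ (∀ (c : ℂ) (x), f (c • x) = c * f x) ∧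
      f 1 = 1 ∧ ∀ x, 0 ≤ (f (star x * x)).re ∧ (f (star x * x)).im = 0 := by
  constructor
  · rintro ⟨ρ, rfl⟩
    exact ⟨ρ.map_add, ρ.map_smul, ρ.map_one, fun x => (isPosElt_complex_iff _).1 (ρ.map_pos x)⟩
  · rintro ⟨h1, h2, h3, h4⟩
    exact ⟨{ toFun := f, map_add' := h1, map_smul' := h2, map_one' := h3,
             map_pos' := fun x => (isPosElt_complex_iff _).2 (h4 x) }, rfl⟩

theorem convex_stateSet : Convex ℝ (stateSet A) := by
  intro f hf g hg a b ha hb hab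
  rw [mem_stateSet_iff] at hf hg ⊢
  obtain ⟨f1, f2, f3, f4⟩ := hf
  obtain ⟨g1, g2, g3, g4⟩ := hg
  have hab' : (a : ℂ) + b = 1 := by exact_mod_cast hab
  refine ⟨fun x y => ?_, fun c x => ?_, ?_, fun x => ?_⟩
  · simp only [Pi.add_apply, Pi.smul_apply, f1, g1, Complex.real_smul]; ring
  · simp only [Pi.add_apply, Pi.smul_apply, f2, g2, Complex.real_smul]; ring
  · simpa only [Pi.add_apply, Pi.smul_apply, f3, g3, Complex.real_smul, mul_one] using hab'
  · have h1 := (f4 x).1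
    have h2 := (g4 x).1
    simp only [Pi.add_apply, Pi.smul_apply, Complex.add_re, Complex.add_im, Complex.smul_re,
      Complex.smul_im, (f4 x).2, (g4 x).2, smul_eq_mul]
    exact ⟨by positivity, by ring⟩

theorem norm_state_le_of_isSelfAdjoint (ρ : PUMap A ℂ) {a : A} (ha : IsSelfAdjoint a) :
    ‖ρ a‖ ≤ ‖a‖ := by
  let _ := CStarAlgebra.spectralOrder A
  have := CStarAlgebra.spectralOrderedRing A
  have key : ∀ b : A, IsSelfAdjoint b → (ρ b).re ≤ ‖b‖ ∧ (ρ b).im = 0 := by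
    intro b hb
    have h := sub_nonneg.2 hb.le_algebraMap_norm_self
    obtain ⟨y, hy⟩ := CStarAlgebra.nonneg_iff_eq_star_mul_self.1 h
    have h1 := (isPosElt_complex_iff _).1 (ρ.map_pos y)
    have h2 : ρ (star y * y) + ρ b = (‖b‖ : ℂ) := by
      rw [← ρ.map_add, ← hy, sub_add_cancel]
      have : (algebraMap ℝ A) ‖b‖ = (‖b‖ : ℂ) • (1 : A) := by
        rw [Algebra.algebraMap_eq_smul_one, ← Complex.coe_smul]
      rw [this, ρ.map_smul, ρ.map_one, smul_eq_mul, mul_one]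
    have hre := congrArg Complex.re h2
    have him := congrArg Complex.im h2
    simp only [Complex.add_re, Complex.add_im, Complex.ofReal_re, Complex.ofReal_im] at hre him
    exact ⟨by linarith [h1.1], by linarith [h1.2]⟩
  have h1 := key a ha
  have h2 := key (-a) ha.neg
  have hneg : ρ (-a) = -ρ a := by
    rw [← neg_one_smul ℂ a, ρ.map_smul, smul_eq_mul, neg_one_mul]
  rw [hneg, norm_neg] at h2
  have h3 : ρ a = ((ρ a).re : ℂ) := Complex.ext (by simp) (by simp [h1.2])
  rw [h3, Complex.norm_real, Real.norm_eq_abs, abs_le]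
  refine ⟨?_, h1.1⟩
  have := h2.1
  simp only [Complex.neg_re] at this
  linarith

theorem norm_state_le (ρ : PUMap A ℂ) (a : A) : ‖ρ a‖ ≤ 2 * ‖a‖ := by
  have h : ρ a = ρ (realPart a : A) + Complex.I * ρ (imaginaryPart a : A) := by
    conv_lhs => rw [← realPart_add_I_smul_imaginaryPart a]
    rw [ρ.map_add, ρ.map_smul, smul_eq_mul]
  have h1 := norm_state_le_of_isSelfAdjoint ρ (realPart a).2
  have h2 := norm_state_le_of_isSelfAdjoint ρ (imaginaryPart a).2
  have h3 : ‖(realPart a : A)‖ ≤ ‖a‖ := realPart.norm_le a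
  have h4 : ‖(imaginaryPart a : A)‖ ≤ ‖a‖ := imaginaryPart.norm_le a
  calc ‖ρ a‖ ≤ ‖ρ (realPart a : A)‖ + ‖Complex.I * ρ (imaginaryPart a : A)‖ := by
        rw [h]; exact norm_add_le _ _
    _ ≤ 2 * ‖a‖ := by
        rw [norm_mul, Complex.norm_I, one_mul]
        linarith

theorem isCompact_stateSet : IsCompact (stateSet A) := by
  have hK : IsCompact (Set.pi Set.univ fun a : A => Metric.closedBall (0 : ℂ) (2 * ‖a‖)) :=
    isCompact_univ_pi fun a => isCompact_closedBall _ _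
  refine hK.of_isClosed_subset ?_ ?_
  · have : stateSet A = {f | (∀ x y, f (x + y) = f x + f y) ∧
        (∀ (c : ℂ) (x), f (c • x) = c * f x) ∧
        f 1 = 1 ∧ ∀ x, 0 ≤ (f (star x * x)).re ∧ (f (star x * x)).im = 0} :=
      Set.ext mem_stateSet_iff
    rw [this]
    simp only [Set.ofPred_and, Set.ofPred_forall]
    refine IsClosed.inter ?_ (IsClosed.inter ?_ (IsClosed.inter ?_ ?_))
    · exact isClosed_iInter fun x => isClosed_iInter fun y =>
        isClosed_eq (by fun_prop) (by fun_prop)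
    · exact isClosed_iInter fun x => isClosed_iInter fun y =>
        isClosed_eq (by fun_prop) (by fun_prop)
    · exact isClosed_eq (by fun_prop) (by fun_prop)
    · exact isClosed_iInter fun x => IsClosed.inter
        (isClosed_le continuous_const (Complex.continuous_re.comp (continuous_apply _)))
        (isClosed_eq (Complex.continuous_im.comp (continuous_apply _)) continuous_const)
  · rintro _ ⟨ρ, rfl⟩ a -
    simpa using norm_state_le ρ a

theorem comp_mem_stateSet {A B : Type*} [CStarAlgebra A] [CStarAlgebra B] (f : PUMap A B)
    {ρ : B → ℂ} (hρ : ρ ∈ stateSet B) : (fun a => ρ (f a)) ∈ stateSet A := by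
  obtain ⟨σ, rfl⟩ := hρ
  exact ⟨σ.comp f, rfl⟩

variable (A)

/-- The state space of a C*-algebra as a compact convex space. -/
noncomputable def stateSpace : ConCom.{u} where
  space := A → ℂ
  carrier := stateSet A
  convex := convex_stateSet
  isCompact := isCompact_stateSet

end StateSpace

/-- The map `ρ ↦ ρ ∘ f` between state spaces induced by a positive unital map `f`. -/
noncomputable def stateSpaceMap {A B : Type u} [CStarAlgebra A] [CStarAlgebra B] (f : PUMap A B) :
    ConCom.Hom (stateSpace B) (stateSpace A) where
  toFun ρ := ⟨fun a => ρ.1 (f a), comp_mem_stateSet f ρ.2⟩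
  continuous_toFun := by
    have h : Continuous fun (g : B → ℂ) (a : A) => g (f a) :=
      continuous_pi fun a => continuous_apply (f a)
    exact (h.comp continuous_subtype_val).subtype_mk _
  map_combo _ _ _ _ _ _ _ := rfl

/-- The state space functor from the opposite of the category of C*-algebras and positive unital
maps to compact convex spaces, given on morphisms by precomposition. -/
noncomputable def stateFunctor : CstPU.{u}ᵒᵖ ⥤ ConCom.{u} where
  obj A := stateSpace A.unop.carrier
  map f := stateSpaceMap f.unop
  map_id _ := rfl
  map_comp _ _ := rfl

/-! States detect everything in a C*-algebra: self-adjointness, positivity, equality and the norm of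
self-adjoint elements. With Kadison's theorem, that continuous affine functions on S(A) are
evaluations at elements of A, this makes S fully faithful, and a fully faithful functor reflects
limits.

For preservation, a continuous map X → S(A) from a compact space X is the same as a positive unital
map A → C(X). The universal property in CstPU, tested on C(X), therefore gives unique continuous
lifts into S(A) (`existsUnique_continuous_lift`). Taking X = V lifts a cone with apex V; taking X =
V × V shows that the lift is affine, because uniqueness identifies the two sides of the affineness
equation. -/

section States

-- States determine order, norm and equality

attribute [local instance] CStarAlgebra.spectralOrder CStarAlgebra.spectralOrderedRing

variable {A B : Type*} [CStarAlgebra A] [CStarAlgebra B]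

theorem isPosElt_iff_nonneg (a : A) : IsPosElt a ↔ 0 ≤ a :=
  CStarAlgebra.nonneg_iff_eq_star_mul_self.symm

namespace PUMap

theorem apply_nonneg (ρ : PUMap A ℂ) {a : A} (ha : 0 ≤ a) : 0 ≤ (ρ a).re ∧ (ρ a).im = 0 := by
  obtain ⟨y, rfl⟩ := (isPosElt_iff_nonneg a).2 ha
  exact (isPosElt_complex_iff _).1 (ρ.map_pos y)

theorem map_sub (f : PUMap A B) (x y : A) : f (x - y) = f x - f y := f.toLinearMap.map_sub x y

theorem map_algebraMap_real (f : PUMap A B) (r : ℝ) :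
    f (algebraMap ℝ A r) = algebraMap ℝ B r := by
  rw [Algebra.algebraMap_eq_smul_one, Algebra.algebraMap_eq_smul_one, ← Complex.coe_smul,
    f.map_smul, f.map_one, Complex.coe_smul]

theorem apply_im_of_isSelfAdjoint (ρ : PUMap A ℂ) {a : A} (ha : IsSelfAdjoint a) :
    (ρ a).im = 0 := by
  have h := (ρ.apply_nonneg (sub_nonneg.2 ha.le_algebraMap_norm_self)).2
  rw [ρ.map_sub, ρ.map_algebraMap_real] at h
  simpa using h

theorem apply_re_eq_realPart (ρ : PUMap A ℂ) (a : A) : ρ (realPart a : A) = (ρ a).re := by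
  have h1 := ρ.apply_im_of_isSelfAdjoint (realPart a).2
  have h2 := ρ.apply_im_of_isSelfAdjoint (imaginaryPart a).2
  have h : ρ a = ρ (realPart a : A) + Complex.I * ρ (imaginaryPart a : A) := by
    conv_lhs => rw [← realPart_add_I_smul_imaginaryPart a]
    rw [ρ.map_add, ρ.map_smul, smul_eq_mul]
  apply Complex.ext <;> simp [h, h1, h2]

end PUMap

/-- Hahn–Banach separates `a` from the closed cone of positive elements; the separating functional
is normalised at 1 and extended complex-linearly. -/
theorem exists_state_re_neg {a : A} (ha : IsSelfAdjoint a) (hna : ¬ 0 ≤ a) :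
    ∃ ρ : PUMap A ℂ, (ρ a).re < 0 := by
  obtain ⟨f, hf, hfa⟩ := (ProperCone.positive ℝ A).hyperplane_separation_point
    (x₀ := a) (by simpa using hna)
  replace hf : ∀ x : A, 0 ≤ x → 0 ≤ f x := fun x hx => hf x (by simpa using hx)
  -- Since `a + ‖a‖` is positive, `f a + ‖a‖ * f 1 ≥ 0`, while `f a < 0`.
  have hf1 : 0 < f 1 := by
    have h := hf _ (by simpa [neg_le_iff_add_nonneg] using ha.neg_algebraMap_norm_le_self)
    rw [Algebra.algebraMap_eq_smul_one, _root_.map_add, _root_.map_smul, smul_eq_mul] at h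
    by_contra hle
    nlinarith [norm_nonneg a]
  -- Precomposing with the real part makes the complex extension real on self-adjoint elements,
  -- because `I • x` then has zero real part.
  let g : A →ₗ[ℝ] ℝ := (f 1)⁻¹ • (f.toLinearMap ∘ₗ (selfAdjoint.submodule ℝ A).subtype ∘ₗ realPart)
  have hg : ∀ x, g x = (f 1)⁻¹ * f (realPart x : A) := fun x => rfl
  have hgsa : ∀ x, IsSelfAdjoint x → g x = (f 1)⁻¹ * f x ∧ g (Complex.I • x) = 0 := by
    intro x hx
    rw [hg, hg, hx.coe_realPart, realPart_I_smul, hx.imaginaryPart]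
    simp
  let G : A →ₗ[ℂ] ℂ := Module.Dual.extendRCLike g
  have hG : ∀ x, IsSelfAdjoint x → G x = ((f 1)⁻¹ * f x : ℝ) := by
    intro x hx
    have := Module.Dual.extendRCLike_apply (𝕜 := ℂ) g x
    erw [this]
    have h2 := (hgsa x hx).2
    simp only [RCLike.I_to_complex]
    rw [h2, (hgsa x hx).1]
    simp
  refine ⟨{ toLinearMap := G, map_one' := ?_, map_pos' := fun x => ?_ }, ?_⟩
  · change G 1 = 1
    rw [hG 1 (.one A), inv_mul_cancel₀ hf1.ne', Complex.ofReal_one]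
  · change IsPosElt (G (star x * x))
    rw [hG _ (.star_mul_self x), isPosElt_complex_iff]
    have := hf _ (star_mul_self_nonneg x)
    exact ⟨by rw [Complex.ofReal_re]; positivity, Complex.ofReal_im _⟩
  · change (G a).re < 0
    rw [hG a ha, Complex.ofReal_re]
    exact mul_neg_of_pos_of_neg (inv_pos.2 hf1) hfa

theorem nonneg_of_forall_state {a : A} (ha : IsSelfAdjoint a)
    (h : ∀ ρ : PUMap A ℂ, 0 ≤ (ρ a).re) : 0 ≤ a := by
  by_contra hna
  obtain ⟨ρ, hρ⟩ := exists_state_re_neg ha hna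
  exact (h ρ).not_gt hρ

/-- The bounds on states give `-c ≤ a ≤ c`, so the spectrum lies in `[-c, c]`; it contains `‖a‖` or
`-‖a‖`. -/
theorem norm_le_of_forall_state {a : A} (ha : IsSelfAdjoint a) {c : ℝ} (hc : 0 ≤ c)
    (h : ∀ ρ : PUMap A ℂ, |(ρ a).re| ≤ c) : ‖a‖ ≤ c := by
  have hsa : IsSelfAdjoint (algebraMap ℝ A c) := IsSelfAdjoint.algebraMap A (.all c)
  have h1 : 0 ≤ algebraMap ℝ A c - a := nonneg_of_forall_state (hsa.sub ha) fun ρ => by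
    rw [ρ.map_sub, ρ.map_algebraMap_real]
    simpa using (abs_le.1 (h ρ)).2
  have h2 : 0 ≤ a - (-algebraMap ℝ A c) := nonneg_of_forall_state (ha.sub hsa.neg) fun ρ => by
    rw [sub_neg_eq_add, ρ.map_add, ρ.map_algebraMap_real]
    have := (abs_le.1 (h ρ)).1
    simp
    linarith
  rcases subsingleton_or_nontrivial A with hA | hA
  · simpa [Subsingleton.elim a 0] using hc
  have hs := (algebraMap_le_iff_le_spectrum (R := ℝ) (r := -c) (a := a) ha).1
    (by simpa using sub_nonneg.1 h2)
  have hs' := (le_algebraMap_iff_spectrum_le (R := ℝ) (r := c) (a := a) ha).1 (sub_nonneg.1 h1)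
  rcases CStarAlgebra.norm_or_neg_norm_mem_spectrum ha with hm | hm
  · exact hs' _ hm
  · linarith [hs _ hm]

theorem eq_zero_of_forall_state {a : A} (h : ∀ ρ : PUMap A ℂ, ρ a = 0) : a = 0 := by
  have key : ∀ b : A, (∀ ρ : PUMap A ℂ, ρ b = 0) → (realPart b : A) = 0 := fun b hb =>
    norm_le_zero_iff.1 <| norm_le_of_forall_state (realPart b).2 le_rfl fun ρ => by
      rw [ρ.apply_re_eq_realPart, hb]; simp
  have h2 := key (-Complex.I • a) fun ρ => by rw [ρ.map_smul, h, smul_zero]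
  rw [← realPart_add_I_smul_imaginaryPart a, key a h]
  simp only [neg_smul, _root_.map_neg, realPart_I_smul, neg_neg] at h2
  simp [h2]

theorem eq_of_forall_state {a b : A} (h : ∀ ρ : PUMap A ℂ, ρ a = ρ b) : a = b :=
  sub_eq_zero.1 <| eq_zero_of_forall_state fun ρ => by rw [ρ.map_sub, h, sub_self]

theorem isSelfAdjoint_of_forall_state {a : A} (h : ∀ ρ : PUMap A ℂ, (ρ a).im = 0) :
    IsSelfAdjoint a := by
  have : (realPart a : A) = a := eq_of_forall_state fun ρ => by
    rw [ρ.apply_re_eq_realPart]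
    exact Complex.ext (by simp) (by simp [h])
  rw [← this]
  exact (realPart a).2

theorem isPosElt_of_forall_state {a : A} (h : ∀ ρ : PUMap A ℂ, IsPosElt (ρ a)) : IsPosElt a := by
  simp only [isPosElt_complex_iff] at h
  exact (isPosElt_iff_nonneg a).2 <|
    nonneg_of_forall_state (isSelfAdjoint_of_forall_state fun ρ => (h ρ).2) fun ρ => (h ρ).1

end States

/-- A continuous linear functional on a product `ι → ℂ` is a linear combination of coordinates;
hence on linear maps out of a vector space `ι` it is evaluation at a point. -/
theorem exists_apply_eq_of_continuous {E : Type*} [AddCommGroup E] [Module ℂ E]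
    (f : (E → ℂ) →L[ℂ] ℂ) : ∃ d : E, ∀ ρ : E →ₗ[ℂ] ℂ, f ρ = ρ d := by
  have hf : f.toLinearMap ∈ Submodule.span ℂ
      (Set.range fun a : E => (LinearMap.proj a : (E → ℂ) →ₗ[ℂ] ℂ)) := by
    have h := LinearMap.mem_span_iff_continuous
      (f := fun a : E => (LinearMap.proj a : (E → ℂ) →ₗ[ℂ] ℂ)) f.toLinearMap
    exact h.2 f.continuous
  suffices h : ∀ g ∈ Submodule.span ℂ
      (Set.range fun a : E => (LinearMap.proj a : (E → ℂ) →ₗ[ℂ] ℂ)),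
      ∃ d : E, ∀ ρ : E →ₗ[ℂ] ℂ, g ρ = ρ d from h _ hf
  intro g hg
  induction hg using Submodule.span_induction with
  | mem g hg =>
    obtain ⟨a, rfl⟩ := hg
    exact ⟨a, fun ρ => rfl⟩
  | zero => exact ⟨0, fun ρ => by simp⟩
  | add g₁ g₂ _ _ h₁ h₂ =>
    obtain ⟨d₁, h₁⟩ := h₁
    obtain ⟨d₂, h₂⟩ := h₂
    exact ⟨d₁ + d₂, fun ρ => by simp [h₁, h₂]⟩
  | smul c g _ h =>
    obtain ⟨d, h⟩ := h
    exact ⟨c • d, fun ρ => by simp [h]⟩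

/-! ### Kadison's function representation -/

section Kadison

variable {A : Type u} [CStarAlgebra A]

/-- A state, as a point of the state space. -/
noncomputable def PUMap.toPoint (ρ : PUMap A ℂ) : (stateSpace A).carrier :=
  (⟨⇑ρ, ρ, rfl⟩ : stateSet A)

theorem exists_toPoint_eq (x : (stateSpace A).carrier) : ∃ ρ : PUMap A ℂ, ρ.toPoint = x := by
  obtain ⟨_, ρ, rfl⟩ := x
  exact ⟨ρ, rfl⟩

/-- The graphs of φ and φ + ε are disjoint compact convex sets. A hyperplane strictly between them
is the graph of an affine function of the ambient space, which on states is given by an element of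
A. -/
theorem exists_approx_of_continuous_affine {φ : (stateSpace A).carrier → ℝ} (hφ : Continuous φ)
    (hφ' : ∀ (a b : ℝ) (ha : 0 ≤ a) (hb : 0 ≤ b) (hab : a + b = 1) (x y),
      φ ((stateSpace A).combo a b ha hb hab x y) = a * φ x + b * φ y)
    {ε : ℝ} (hε : 0 < ε) :
    ∃ a : A, IsSelfAdjoint a ∧ ∀ ρ : PUMap A ℂ, |(ρ a).re - φ ρ.toPoint| ≤ ε := by
  rcases isEmpty_or_nonempty (PUMap A ℂ) with hA | ⟨⟨ρ₀⟩⟩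
  · exact ⟨0, .zero A, fun ρ => hA.elim ρ⟩
  let graph (s : ℝ) : Set ((A → ℂ) × ℝ) := Set.range fun x : stateSet A => (x.1, φ x + s)
  have hcompact : CompactSpace (stateSet A) := isCompact_iff_compactSpace.1 isCompact_stateSet
  have hgc (s) : IsCompact (graph s) :=
    isCompact_range (continuous_subtype_val.prodMk ((hφ : Continuous φ).add continuous_const))
  have hgconv (s) : Convex ℝ (graph s) := by
    rintro _ ⟨x, rfl⟩ _ ⟨y, rfl⟩ a b ha hb hab
    refine ⟨(stateSpace A).combo a b ha hb hab x y, Prod.ext rfl ?_⟩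
    have := hφ' a b ha hb hab x y
    simp only [Prod.smul_mk, Prod.mk_add_mk, smul_eq_mul]
    rw [this]
    linear_combination (-s) * hab
  have hdisj : Disjoint (graph 0) (graph ε) := by
    rw [Set.disjoint_left]
    rintro _ ⟨x, rfl⟩ ⟨y, hy⟩
    simp only [Prod.mk.injEq] at hy
    obtain ⟨hxy, hy⟩ := hy
    obtain rfl : y = x := Subtype.ext hxy
    linarith
  obtain ⟨F, u, v, hu, huv, hv⟩ := geometric_hahn_banach_compact_closed (hgconv 0) (hgc 0)
    (hgconv ε) (hgc ε).isClosed hdisj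
  let ℓ : (A → ℂ) →L[ℝ] ℝ := F.comp (.inl ℝ _ _)
  let t : ℝ := F (0, 1)
  have hF : ∀ x s, F (x, s) = ℓ x + s * t := fun x s => by
    have : (x, s) = (x, (0 : ℝ)) + s • ((0 : A → ℂ), (1 : ℝ)) := by simp
    rw [this, _root_.map_add, _root_.map_smul]; rfl
  obtain ⟨d, hd⟩ := exists_apply_eq_of_continuous (StrongDual.extendRCLike (𝕜 := ℂ) ℓ)
  have hℓ : ∀ ρ : PUMap A ℂ, ℓ ρ = (ρ d).re := fun ρ => by
    have h1 := hd ρ.toLinearMap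
    have h2 := congrArg Complex.re h1
    rw [StrongDual.extendRCLike_apply] at h2
    simp at h2
    exact h2
  have hu' : ∀ ρ : PUMap A ℂ, (ρ d).re + φ ρ.toPoint * t < u := fun ρ => by
    have := hu _ ⟨ρ.toPoint, rfl⟩
    rw [hF, add_zero] at this
    rw [← hℓ]
    exact this
  have hv' : ∀ ρ : PUMap A ℂ, v < (ρ d).re + (φ ρ.toPoint + ε) * t := fun ρ => by
    have := hv _ ⟨ρ.toPoint, rfl⟩
    rw [hF] at this
    rw [← hℓ]
    exact this
  -- Comparing both bounds at `ρ₀` gives `ε * t > v - u > 0`: the hyperplane is not vertical.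
  have ht : 0 < t := by
    have h1 := hu' ρ₀
    have h2 := hv' ρ₀
    by_contra hle
    nlinarith
  -- Solves the hyperplane equation `(ρ d).re + y * t = u` for the height `y`.
  let a : A := t⁻¹ • (algebraMap ℝ A u - (realPart d : A))
  have ha : ∀ ρ : PUMap A ℂ, (ρ a).re = t⁻¹ * (u - (ρ d).re) := fun ρ => by
    have : a = (t⁻¹ : ℂ) • (algebraMap ℝ A u - (realPart d : A)) := by
      rw [← Complex.ofReal_inv, Complex.coe_smul]
    rw [this, ρ.map_smul, ρ.map_sub, ρ.map_algebraMap_real, ρ.apply_re_eq_realPart,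
      ← Complex.ofReal_inv]
    simp
  refine ⟨a, ?_, fun ρ => ?_⟩
  · exact ((IsSelfAdjoint.algebraMap A (.all u)).sub (realPart d).2) |> (IsSelfAdjoint.all _).smul
  · rw [ha, abs_le]
    have h1 := hu' ρ
    have h2 := hv' ρ
    have e : t⁻¹ * (u - (ρ d).re) - φ ρ.toPoint = (u - (ρ d).re - φ ρ.toPoint * t) / t := by
      field_simp
    rw [e]
    constructor
    · rw [le_div_iff₀ ht]
      nlinarith
    · rw [div_le_iff₀ ht]
      nlinarith

/-- Kadison's function representation: every real continuous affine function on the state space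
is evaluation at a self-adjoint element. -/
theorem exists_isSelfAdjoint_apply_eq {φ : (stateSpace A).carrier → ℝ} (hφ : Continuous φ)
    (hφ' : ∀ (a b : ℝ) (ha : 0 ≤ a) (hb : 0 ≤ b) (hab : a + b = 1) (x y),
      φ ((stateSpace A).combo a b ha hb hab x y) = a * φ x + b * φ y) :
    ∃ a : A, ∀ ρ : PUMap A ℂ, ρ a = φ ρ.toPoint := by
  choose a ha hφa using fun n : ℕ =>
    exists_approx_of_continuous_affine hφ hφ' (ε := (1 / 2) ^ n) (by positivity)
  have hcauchy : CauchySeq a := by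
    -- Consecutive errors add up to `(1/2)^n + (1/2)^(n+1) ≤ 2 * (1/2)^n`, and states control the
    -- norm.
    refine cauchySeq_of_le_geometric (1 / 2) 2 (by norm_num) fun n => ?_
    rw [dist_eq_norm]
    refine norm_le_of_forall_state ((ha n).sub (ha (n + 1))) (by positivity) fun ρ => ?_
    have h1 := abs_le.1 (hφa n ρ)
    have h2 := abs_le.1 (hφa (n + 1) ρ)
    have h3 : (0 : ℝ) < (1 / 2) ^ n := by positivity
    rw [pow_succ] at h2
    rw [ρ.map_sub, Complex.sub_re, abs_le]
    constructor <;> linarith [h1.1, h1.2, h2.1, h2.2]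
  obtain ⟨b, hb⟩ := cauchySeq_tendsto_of_complete hcauchy
  refine ⟨b, fun ρ => ?_⟩
  have hρ : Continuous ρ :=
    AddMonoidHomClass.continuous_of_bound ρ.toLinearMap 2 (norm_state_le ρ)
  have h1 : Filter.Tendsto (fun n => ρ (a n)) Filter.atTop (nhds (ρ b)) :=
    (hρ.tendsto b).comp hb
  refine tendsto_nhds_unique h1 ?_
  rw [tendsto_iff_norm_sub_tendsto_zero]
  refine squeeze_zero (fun _ => norm_nonneg _) (fun n => ?_)
    (tendsto_pow_atTop_nhds_zero_of_lt_one (r := (1 / 2 : ℝ)) (by norm_num) (by norm_num))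
  have : ρ (a n) = ((ρ (a n)).re : ℂ) :=
    Complex.ext (by simp) (by simp [ρ.apply_im_of_isSelfAdjoint (ha n)])
  rw [this, ← Complex.ofReal_sub, Complex.norm_real]
  exact hφa n ρ

theorem exists_apply_eq_of_continuous_affine {φ : (stateSpace A).carrier → ℂ} (hφ : Continuous φ)
    (hφ' : ∀ (a b : ℝ) (ha : 0 ≤ a) (hb : 0 ≤ b) (hab : a + b = 1) (x y),
      φ ((stateSpace A).combo a b ha hb hab x y) = a * φ x + b * φ y) :
    ∃ a : A, ∀ ρ : PUMap A ℂ, ρ a = φ ρ.toPoint := by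
  obtain ⟨a, ha⟩ := exists_isSelfAdjoint_apply_eq (Complex.continuous_re.comp hφ)
    fun a b ha hb hab x y => by simp [hφ']
  obtain ⟨b, hb⟩ := exists_isSelfAdjoint_apply_eq (Complex.continuous_im.comp hφ)
    fun a b ha hb hab x y => by simp [hφ']
  refine ⟨a + Complex.I • b, fun ρ => ?_⟩
  rw [ρ.map_add, ρ.map_smul, ha, hb, smul_eq_mul, mul_comm]
  exact Complex.re_add_im _

end Kadison

/-! ### Full faithfulness of the state space functor -/

theorem stateSpaceMap_injective {A B : Type u} [CStarAlgebra A] [CStarAlgebra B] :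
    Function.Injective (stateSpaceMap : PUMap A B → _) := by
  intro f g h
  ext x
  refine eq_of_forall_state fun ρ => ?_
  have := congrArg (fun k => (k.toFun ρ.toPoint).1) h
  exact congrFun this x

/-- For each `x`, the function `s ↦ h(s)(x)` is continuous and affine, so Kadison's theorem yields
the image of `x`. Linearity, unit and positivity are then checked on states. -/
theorem stateSpaceMap_surjective {A B : Type u} [CStarAlgebra A] [CStarAlgebra B] :
    Function.Surjective (stateSpaceMap : PUMap A B → _) := by
  intro h
  have hrep : ∀ x : A, ∃ y : B, ∀ ρ : PUMap B ℂ, ρ y = (h.toFun ρ.toPoint).1 x := fun x => by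
    refine exists_apply_eq_of_continuous_affine (φ := fun s => (h.toFun s).1 x) ?_ ?_
    · have hx : Continuous fun s : stateSet A => s.1 x :=
        (continuous_apply x).comp continuous_subtype_val
      exact hx.comp h.continuous_toFun
    · intro a b ha hb hab s t
      rw [h.map_combo]
      rfl
  choose f hf using hrep
  choose σ hσ using fun ρ : PUMap B ℂ => exists_toPoint_eq (h.toFun ρ.toPoint)
  have hf' : ∀ (ρ : PUMap B ℂ) x, ρ (f x) = σ ρ x := fun ρ x => by
    rw [hf, ← hσ]; rfl
  let F : PUMap A B :=
    { toFun := f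
      map_add' := fun x y => eq_of_forall_state fun ρ => by
        rw [ρ.map_add]; simp only [hf', (σ ρ).map_add]
      map_smul' := fun c x => eq_of_forall_state fun ρ => by
        rw [RingHom.id_apply, ρ.map_smul, hf', hf', (σ ρ).map_smul]
      map_one' := eq_of_forall_state fun ρ => by
        rw [hf', (σ ρ).map_one, ρ.map_one]
      map_pos' := fun x => isPosElt_of_forall_state fun ρ => by
        rw [hf']
        exact (σ ρ).map_pos x }
  refine ⟨F, ConCom.Hom.ext (funext fun s => ?_)⟩
  obtain ⟨ρ, rfl⟩ := exists_toPoint_eq s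
  exact Subtype.ext (funext fun x => hf x ρ)

instance : stateFunctor.{u}.Faithful where
  map_injective h := Quiver.Hom.unop_inj (stateSpaceMap_injective h)

instance : stateFunctor.{u}.Full where
  map_surjective h := by
    obtain ⟨f, hf⟩ := stateSpaceMap_surjective h
    exact ⟨Quiver.Hom.op f, hf⟩

/-! ### Positive unital maps into C(X) as continuous families of states -/

section ContinuousFunctions

variable {A : Type*} [CStarAlgebra A] {X : Type*} [TopologicalSpace X] [CompactSpace X]

theorem isPosElt_continuousMap {g : C(X, ℂ)} (hg : ∀ x, IsPosElt (g x)) : IsPosElt g := by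
  simp only [isPosElt_complex_iff] at hg
  refine ⟨⟨fun x => (Real.sqrt (g x).re : ℂ), by fun_prop⟩, ?_⟩
  ext x
  simp only [ContinuousMap.mul_apply, ContinuousMap.star_apply, ContinuousMap.coe_mk,
    Complex.star_def, Complex.conj_ofReal]
  rw [← Complex.ofReal_mul, Real.mul_self_sqrt (hg x).1]
  exact Complex.ext (by simp) (by simp [(hg x).2])

/-- The positive unital map `A → C(X)` given by a continuous family of states of `A`. -/
noncomputable def PUMap.ofFamily (s : X → stateSet A) (hs : Continuous s) : PUMap A C(X, ℂ) where
  toFun a := ⟨fun x => (s x).1 a, (continuous_apply a).comp (continuous_subtype_val.comp hs)⟩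
  map_add' a b := ContinuousMap.ext fun x => ((mem_stateSet_iff _).1 (s x).2).1 a b
  map_smul' c a := ContinuousMap.ext fun x => ((mem_stateSet_iff _).1 (s x).2).2.1 c a
  map_one' := ContinuousMap.ext fun x => ((mem_stateSet_iff _).1 (s x).2).2.2.1
  map_pos' a := isPosElt_continuousMap fun x =>
    (isPosElt_complex_iff _).2 (((mem_stateSet_iff _).1 (s x).2).2.2.2 a)

/-- Evaluation at a point as a state of `C(X)`. -/
noncomputable def PUMap.evalAt (x : X) : PUMap C(X, ℂ) ℂ where
  toFun g := g x
  map_add' _ _ := rfl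
  map_smul' _ _ := rfl
  map_one' := rfl
  map_pos' g := ⟨g x, rfl⟩

/-- The family of states of `A` given by a positive unital map `A → C(X)`. -/
noncomputable def PUMap.family (f : PUMap A C(X, ℂ)) (x : X) : stateSet A :=
  ⟨fun a => f a x, (PUMap.evalAt x).comp f, rfl⟩

theorem PUMap.continuous_family (f : PUMap A C(X, ℂ)) : Continuous f.family :=
  (continuous_pi fun a => (f a).continuous).subtype_mk _

end ContinuousFunctions

/-! ### Preservation and reflection of limits -/

section Limits

variable {J : Type w} [Category.{w'} J] {K : J ⥤ CstPU.{u}ᵒᵖ}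

/-- The compatible families `s j` turn C(X) into the apex of a cone over `K`. No convex structure on
X is involved. -/
theorem existsUnique_continuous_lift {c : Limits.Cone K} (hc : Limits.IsLimit c)
    {X : Type u} [TopologicalSpace X] [CompactSpace X]
    (s : ∀ j, X → stateSet (K.obj j).unop.carrier) (hs : ∀ j, Continuous (s j))
    (hsK : ∀ {i j} (k : i ⟶ j) x, (stateFunctor.map (K.map k)).toFun (s i x) = s j x) :
    ∃! h : X → stateSet c.pt.unop.carrier, Continuous h ∧
      ∀ j x, (stateFunctor.map (c.π.app j)).toFun (h x) = s j x := by
  let d : Limits.Cone K :=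
    { pt := Opposite.op ⟨C(X, ℂ)⟩
      π :=
        { app := fun j => Quiver.Hom.op (PUMap.ofFamily (s j) (hs j) :
            PUMap (K.obj j).unop.carrier C(X, ℂ))
          naturality := fun i j k => by
            apply Quiver.Hom.unop_inj
            refine PUMap.ext fun a => ContinuousMap.ext fun x => ?_
            exact (congrFun (congrArg Subtype.val (hsK k x)) a).symm } }
  have hd (j) (a : (K.obj j).unop.carrier) (x : X) :
      (show PUMap _ C(X, ℂ) from (d.π.app j).unop) a x = (s j x).1 a := rfl
  let l : PUMap c.pt.unop.carrier C(X, ℂ) := (hc.lift d).unop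
  refine ⟨l.family, ⟨l.continuous_family, fun j x => Subtype.ext (funext fun a => ?_)⟩, ?_⟩
  · have := congrArg (fun f => (show PUMap _ C(X, ℂ) from f.unop) a x) (hc.fac d j)
    exact this
  · rintro h ⟨hcont, hfac⟩
    have hl : PUMap.ofFamily h hcont = l := by
      have := hc.uniq d (Quiver.Hom.op (PUMap.ofFamily h hcont :
        PUMap c.pt.unop.carrier C(X, ℂ))) fun j => by
          apply Quiver.Hom.unop_inj
          refine PUMap.ext fun a => ContinuousMap.ext fun x => ?_
          exact congrFun (congrArg Subtype.val (hfac j x)) a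
      exact congrArg Quiver.Hom.unop this
    rw [← hl]
    rfl

theorem ConCom.continuous_combo (V : ConCom.{u}) (a b : ℝ) (ha : 0 ≤ a) (hb : 0 ≤ b)
    (hab : a + b = 1) :
    Continuous fun p : V.carrier × V.carrier => V.combo a b ha hb hab p.1 p.2 :=
  Continuous.subtype_mk (by fun_prop) _

theorem existsUnique_lift {c : Limits.Cone K} (hc : Limits.IsLimit c)
    (s : Limits.Cone (K ⋙ stateFunctor)) :
    ∃! h : s.pt ⟶ stateFunctor.obj c.pt, ∀ j, h ≫ stateFunctor.map (c.π.app j) = s.π.app j := by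
  have hV : CompactSpace s.pt.carrier := isCompact_iff_compactSpace.1 s.pt.isCompact
  have hsK {i j} (k : i ⟶ j) (x) : (stateFunctor.map (K.map k)).toFun ((s.π.app i).toFun x) =
      (s.π.app j).toFun x := congrArg (fun f => f.toFun x) (s.w k)
  have hcs (j) : Continuous fun x : s.pt.carrier => (s.π.app j).toFun x :=
    (s.π.app j).continuous_toFun
  obtain ⟨h, ⟨hcont, hfac⟩, huniq⟩ := existsUnique_continuous_lift hc (X := s.pt.carrier)
    (fun j => (s.π.app j).toFun) hcs (fun k x => hsK k x)
  refine ⟨⟨h, hcont, fun a b ha hb hab x y => ?_⟩, fun j => ?_, fun g hg => ?_⟩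
  · have hcombo := s.pt.continuous_combo a b ha hb hab
    have hcombo' := (stateFunctor.obj c.pt).continuous_combo a b ha hb hab
    -- Both `h (a x + b y)` and `a h x + b h y` are continuous lifts of the same family on V × V,
    -- hence equal.
    obtain ⟨k, -, hk⟩ := existsUnique_continuous_lift hc (X := s.pt.carrier × s.pt.carrier)
      (fun j p => (s.π.app j).toFun (s.pt.combo a b ha hb hab p.1 p.2))
      (fun j => (hcs j).comp hcombo) (fun k p => hsK k _)
    have h1 := hk (fun p => h (s.pt.combo a b ha hb hab p.1 p.2))
      ⟨hcont.comp hcombo, fun j p => hfac j _⟩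
    have h2 := hk (fun p => (stateFunctor.obj c.pt).combo a b ha hb hab (h p.1) (h p.2))
      ⟨hcombo'.comp ((hcont.comp continuous_fst).prodMk (hcont.comp continuous_snd)),
        fun j p => by
          erw [(stateFunctor.map (c.π.app j)).map_combo, hfac, hfac]
          exact ((s.π.app j).map_combo a b ha hb hab _ _).symm⟩
    exact congrFun (h1.trans h2.symm) (x, y)
  · exact ConCom.Hom.ext (funext fun x => hfac j x)
  · exact ConCom.Hom.ext (huniq g.toFun ⟨g.continuous_toFun, fun j x =>
      congrArg (fun f => f.toFun x) (hg j)⟩)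

end Limits

instance : Limits.PreservesLimitsOfSize.{w', w} stateFunctor.{u} where
  preservesLimitsOfShape :=
    { preservesLimit :=
        { preserves := fun hc => ⟨Limits.IsLimit.ofExistsUnique (existsUnique_lift hc)⟩ } }

theorem lemma3p1 :
    Limits.PreservesLimitsOfSize.{w', w} stateFunctor.{u} ∧
    Limits.ReflectsLimitsOfSize.{w', w} stateFunctor.{u} ∧
    ∀ (J : Type w) [Category.{w'} J] (F : J ⥤ CstPU.{u}) (c : Limits.Cocone F),
      Nonempty (Limits.IsColimit c) ↔
        Nonempty (Limits.IsLimit (stateFunctor.{u}.mapCone c.op)) := by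
  -- The second instance comes from full faithfulness.
  refine ⟨inferInstance, inferInstance, fun J _ F c => ⟨fun ⟨hc⟩ => ?_, fun ⟨hc⟩ => ?_⟩⟩
  · exact ⟨Limits.isLimitOfPreserves stateFunctor hc.op⟩
  · exact ⟨Limits.isColimitOfOp (Limits.isLimitOfReflects stateFunctor hc)⟩
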